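/- Let $1/2<\gamma\le 1$, $x_0\in\mathbb R$, and let $g:\mathbb R\to\mathbb R$ be Hölder continuous with exponent $\gamma$ on every interval $[0,R]$, $R>0$ (in particular, any $g\in C^{\gamma}(\mathbb R)$ is allowed). Let $b,\sigma:[0,\infty)\times\mathbb R\to\mathbb R$. Suppose that $b$ is globally Lipschitz in $(t,x)$ and that $\sigma$ is of class $C^1$ on $[0,\infty)\times\mathbb R$ (with one-sided $t$-derivatives at $t=0$), with $\sigma$, $\partial\sigma/\partial t$ and $\partial\sigma/\partial x$ globally Lipschitz in $(t,x)$ on $[0,\infty)\times\mathbb R$. Then for every $T>0$ and every $\beta$ with $1-\gamma<\beta<\gamma$, the equation \[ dx(t)=b(t,x(t))\,dt+\sigma(t,x(t))\,dg(t),\qquad x(0)=x_0, \] has exactly one solution in $C^{\beta}([0,T])$, the space of functions on $[0,T]$ that are Hölder continuous with exponent $\beta$. Here $x\in C^\beta([0,T])$ is a solution if $x(0)=x_0$ and, for every $t\in[0,T]$, the Riemann--Stieltjes integral below (the limit of the Riemann--Stieltjes sums over tagged partitions of $[0,t]$ as the mesh tends to zero) exists and \[ x(t)=x_0+\int_0^t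 b(\tau,x(\tau))\,d\tau+\int_0^t\sigma(\tau,x(\tau))\,dg(\tau). \] -/

import Mathlib

open Set
open scoped NNReal

/-- `f` belongs to `C^β(s)`: it is Hölder continuous with exponent `β` on the set `s`. -/
def HolderOn (β : ℝ≥0) (f : ℝ → ℝ) (s : Set ℝ) : Prop :=
  ∃ C : ℝ≥0, HolderOnWith C β f s

/-- The function `h (t, x)` is globally Lipschitz in `t` and `x` on `[0, ∞) × ℝ`. -/
def GloballyLipschitz (h : ℝ → ℝ → ℝ) : Prop :=
  ∃ C : ℝ≥0, LipschitzOnWith C (fun p : ℝ × ℝ => h p.1 p.2) (Ici 0 ×ˢ univ)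

/-- The partial derivative in `t ∈ [0, ∞)` (one-sided at `t = 0`) of a function of `(t, x)`. -/
noncomputable def partialT (h : ℝ → ℝ → ℝ) (t x : ℝ) : ℝ :=
  derivWithin (fun s => h s x) (Ici 0) t

/-- The partial derivative in `x ∈ ℝ` of a function of `(t, x)`. -/
noncomputable def partialX (h : ℝ → ℝ → ℝ) (t x : ℝ) : ℝ :=
  deriv (fun y => h t y) x

/-- For `s ≤ t`: the Riemann–Stieltjes integral `∫_s^t f dg` exists and is equal to `I`, i.e. the
sums `∑ f (τ i) * (g (u (i + 1)) - g (u i))` over the partitions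
`s = u 0 ≤ u 1 ≤ ⋯ ≤ u n = t` with tags `τ i ∈ [u i, u (i + 1)]` converge to `I` as the mesh of
the partition tends to zero. -/
def HasStieltjesIntegral (f g : ℝ → ℝ) (s t I : ℝ) : Prop :=
  ∀ ε > 0, ∃ δ > 0, ∀ (n : ℕ) (u τ : ℕ → ℝ), u 0 = s → u n = t →
    (∀ i < n, u i ≤ τ i ∧ τ i ≤ u (i + 1) ∧ u (i + 1) - u i < δ) →
    |∑ i ∈ Finset.range n, f (τ i) * (g (u (i + 1)) - g (u i)) - I| < ε

/-- `x` is a solution on `[0, T]` of `dx(t) = b(t, x(t)) dt + σ(t, x(t)) dg(t)`, `x(0) = x₀`: for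
every `t ∈ [0, T]` the Stieltjes integral of `σ(τ, x(τ))` against `g` over `[0, t]` exists, and
`x(t) = x₀ + ∫_0^t b(τ, x(τ)) dτ + ∫_0^t σ(τ, x(τ)) dg(τ)`. -/
def IsSolution (b σ : ℝ → ℝ → ℝ) (g : ℝ → ℝ) (x₀ T : ℝ) (x : ℝ → ℝ) : Prop :=
  x 0 = x₀ ∧ ∀ t ∈ Icc 0 T,
    IntervalIntegrable (fun τ => b τ (x τ)) MeasureTheory.volume 0 t ∧
    ∃ I : ℝ, HasStieltjesIntegral (fun τ => σ τ (x τ)) g 0 t I ∧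
      x t = x₀ + (∫ τ in (0 : ℝ)..t, b τ (x τ)) + I

/-! Since β + γ > 1, the `dg` integral is a Young integral and the equation is a fixed point
problem. Bisecting a partition near its midpoint shows that a left-point sum over an interval of
length ℓ differs from f(u₀)(g(uₙ) − g(u₀)) by O(ℓ^(β+γ)), uniformly in the number of points
(`abs_sum_sub_le`). Dyadic sums therefore converge to a function F with F(t) − F(s) = f(s)(g(t) −
g(s)) + O((t − s)^(β+γ)). Because the error is superlinear, F is a primitive for the
Riemann–Stieltjes integral (`exists_primitive`), and the integral obeys Young's estimate
(`HasStieltjesIntegral.abs_sub_le`).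

On an interval of length at most h ≤ 1, drift and Young integral together have β-Hölder size of
order h^(γ−β) (`abs_integral_add_le`). Instead of solving on short intervals and gluing, increments
over lags at most h are compared with exp(t/h): crossing [0, t] in steps of h then costs only a
geometric series, so one argument covers all of [0, T].

With this weight the Picard map preserves the unit ball at some scale h₁, thanks to the linear
growth of the coefficients (`IsPicardStep.weightedBound`). At a second scale, depending on a Hölder
constant R of the curves, it halves distances (`IsPicardStep.weightedBound_sub`); this uses that
∂σ/∂x is bounded and Lipschitz, through `abs_four_point_le`. Iteration gives a solution, and
repeated halving of the distance between two solutions gives uniqueness. -/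

open Filter Topology

/-! ### Hölder increments and ordered partitions -/

/-- On `[a, b]`, the function `f` is Hölder continuous with exponent `β` and constant `A`. -/
def HolderBound (f : ℝ → ℝ) (A β a b : ℝ) : Prop :=
  ∀ u v, a ≤ u → u ≤ v → v ≤ b → |f v - f u| ≤ A * (v - u) ^ β

lemma HolderBound.mono {f : ℝ → ℝ} {A β a b a' b' : ℝ} (hf : HolderBound f A β a b)
    (ha : a ≤ a') (hb : b' ≤ b) : HolderBound f A β a' b' :=
  fun u v h1 h2 h3 => hf u v (ha.trans h1) h2 (h3.trans hb)

lemma HolderBound.abs_mul_le {f g : ℝ → ℝ} {A G β γ a b : ℝ} (hβ : 0 ≤ β) (hγ : 0 ≤ γ)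
    (hA : 0 ≤ A) (hG : 0 ≤ G)
    (hf : HolderBound f A β a b) (hg : HolderBound g G γ a b) {u v p q δ : ℝ}
    (hau : a ≤ u) (huv : u ≤ v) (hvb : v ≤ b) (hap : a ≤ p) (hpq : p ≤ q) (hqb : q ≤ b)
    (hδ1 : v - u ≤ δ) (hδ2 : q - p ≤ δ) :
    |(f v - f u) * (g q - g p)| ≤ A * G * δ ^ (β + γ) := by
  have hδ : 0 ≤ δ := by linarith
  rw [abs_mul, Real.rpow_add_of_nonneg hδ hβ hγ]
  have h1 : |f v - f u| ≤ A * δ ^ β := (hf u v hau huv hvb).trans (by gcongr)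
  have h2 : |g q - g p| ≤ G * δ ^ γ := (hg p q hap hpq hqb).trans (by gcongr)
  calc |f v - f u| * |g q - g p| ≤ (A * δ ^ β) * (G * δ ^ γ) := by gcongr
    _ = _ := by ring

lemma exists_le_and_le_succ {u : ℕ → ℝ} {m : ℝ} (n : ℕ) (h0 : u 0 ≤ m) (h1 : m ≤ u (n + 1)) :
    ∃ k ≤ n, u k ≤ m ∧ m ≤ u (k + 1) := by
  induction n with
  | zero => exact ⟨0, le_rfl, h0, h1⟩
  | succ n ih =>
    by_cases h : m ≤ u (n + 1)
    · obtain ⟨k, hk, h⟩ := ih h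
      exact ⟨k, by omega, h⟩
    · exact ⟨n + 1, le_rfl, (not_le.1 h).le, h1⟩

lemma le_of_forall_le_succ {u : ℕ → ℝ} {n : ℕ} (h : ∀ i < n, u i ≤ u (i + 1)) {i j : ℕ}
    (hij : i ≤ j) (hj : j ≤ n) : u i ≤ u j := by
  induction j, hij using Nat.le_induction with
  | base => exact le_rfl
  | succ j hij ih => exact (ih (by omega)).trans (h j (by omega))

/-! ### Young's inequality for left-point sums -/

/-- The constant in Young's maximal inequality with total exponent `θ`. -/
noncomputable def youngConst (θ : ℝ) : ℝ := 2 / (1 - 2 ^ (1 - θ))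

lemma two_rpow_lt_one {θ : ℝ} (hθ : 1 < θ) : (2 : ℝ) ^ (1 - θ) < 1 :=
  Real.rpow_lt_one_of_one_lt_of_neg one_lt_two (by linarith)

lemma youngConst_pos {θ : ℝ} (hθ : 1 < θ) : 0 < youngConst θ :=
  div_pos two_pos (by linarith [two_rpow_lt_one hθ])

/-- Young's maximal inequality for left-point Riemann–Stieltjes sums. -/
theorem abs_sum_sub_le {f g : ℝ → ℝ} {A G β γ a b : ℝ} (hβ : 0 ≤ β) (hγ : 0 ≤ γ)
    (hθ : 1 < β + γ) (hA : 0 ≤ A) (hG : 0 ≤ G)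
    (hf : HolderBound f A β a b) (hg : HolderBound g G γ a b) (n : ℕ) :
    ∀ u : ℕ → ℝ, (∀ i < n, u i ≤ u (i + 1)) → a ≤ u 0 → u n ≤ b →
      |∑ i ∈ Finset.range n, f (u i) * (g (u (i + 1)) - g (u i)) - f (u 0) * (g (u n) - g (u 0))|
        ≤ youngConst (β + γ) * (A * G) * (u n - u 0) ^ (β + γ) := by
  have hK := youngConst_pos hθ
  have hAG : 0 ≤ A * G := mul_nonneg hA hG
  induction n using Nat.strong_induction_on with
  | _ n ih =>
  intro u hu ha hb
  rcases n with _ | n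
  · simp [Real.zero_rpow (by linarith : β + γ ≠ 0)]
  have hmono := fun {i j : ℕ} => le_of_forall_le_succ hu (i := i) (j := j)
  have hl : u 0 ≤ u (n + 1) := hmono (Nat.zero_le _) le_rfl
  -- Cut out the cell containing the midpoint: the blocks on either side of it each have at most
  -- half the total length, however long the cell is.
  obtain ⟨k, hkn, hk1, hk2⟩ := exists_le_and_le_succ (u := u) (m := (u 0 + u (n + 1)) / 2) n
    (by linarith) (by linarith)
  obtain ⟨r, rfl⟩ := Nat.exists_eq_add_of_le hkn
  have e1 := ih k (by omega) u (fun i hi => hu i (by omega)) ha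
    ((hmono (by omega) le_rfl).trans hb)
  have e2 := ih r (by omega) (fun i => u (k + 1 + i)) (fun i hi => hu _ (by omega))
    (ha.trans (hmono (by omega) (by omega))) (by rwa [show k + 1 + r = k + r + 1 by omega])
  have m1 : u 0 ≤ u k := hmono (by omega) (by omega)
  have m2 : u k ≤ u (k + 1) := hmono (by omega) (by omega)
  have m3 : u (k + 1) ≤ u (k + r + 1) := hmono (by omega) (by omega)
  -- `e3` and `e4` bound the two cross terms that arise when f(u k) and f(u (k + 1)) are replaced by
  -- f(u 0).
  have e3 := HolderBound.abs_mul_le hβ hγ hA hG hf hg (δ := u (k + r + 1) - u 0) ha m1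
    (by linarith) (by linarith) m2 (by linarith) (by linarith) (by linarith)
  have e4 := HolderBound.abs_mul_le hβ hγ hA hG hf hg (δ := u (k + r + 1) - u 0) ha
    (m1.trans m2) (by linarith) (by linarith) m3 (by linarith) (by linarith) (by linarith)
  have hsum : ∑ i ∈ Finset.range (k + r + 1), f (u i) * (g (u (i + 1)) - g (u i))
      = ∑ i ∈ Finset.range k, f (u i) * (g (u (i + 1)) - g (u i))
        + f (u k) * (g (u (k + 1)) - g (u k))
        + ∑ i ∈ Finset.range r, f (u (k + 1 + i)) * (g (u (k + 1 + i + 1)) - g (u (k + 1 + i))) := by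
    rw [show k + r + 1 = k + 1 + r by omega, Finset.sum_range_add, Finset.sum_range_succ]
  rw [hsum]
  simp only [add_zero, ← add_assoc] at e2
  rw [show k + 1 + r = k + r + 1 by omega] at e2
  set ℓ := u (k + r + 1) - u 0 with hℓ
  have hℓ0 : 0 ≤ ℓ := by linarith
  have hhalf : (ℓ / 2) ^ (β + γ) = 2 ^ (1 - (β + γ)) / 2 * ℓ ^ (β + γ) := by
    rw [Real.div_rpow hℓ0 two_pos.le, Real.rpow_sub two_pos, Real.rpow_one]
    field_simp
  have e1' : youngConst (β + γ) * (A * G) * (u k - u 0) ^ (β + γ)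
      ≤ youngConst (β + γ) * (A * G) * (ℓ / 2) ^ (β + γ) := by
    gcongr
    linarith
  have e2' : youngConst (β + γ) * (A * G) * (u (k + r + 1) - u (k + 1)) ^ (β + γ)
      ≤ youngConst (β + γ) * (A * G) * (ℓ / 2) ^ (β + γ) := by
    gcongr
    linarith
  -- The constant is the fixed point of K ↦ 2^(1−θ) K + 2: two half-length blocks plus two cross
  -- terms.
  have hKeq : youngConst (β + γ) * 2 ^ (1 - (β + γ)) + 2 = youngConst (β + γ) := by
    have : 1 - (2 : ℝ) ^ (1 - (β + γ)) ≠ 0 := by linarith [two_rpow_lt_one hθ]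
    unfold youngConst
    field_simp
    ring
  have hfin : youngConst (β + γ) * (A * G) * (ℓ / 2) ^ (β + γ) * 2
      + 2 * (A * G * ℓ ^ (β + γ)) = youngConst (β + γ) * (A * G) * ℓ ^ (β + γ) := by
    rw [hhalf]
    linear_combination (A * G * ℓ ^ (β + γ)) * hKeq
  rw [abs_le] at e1 e2 e3 e4 ⊢
  constructor <;> nlinarith only [e1, e2, e3, e4, e1', e2', hfin]

/-! ### Construction of the Young integral -/

/-- A function whose increments are approximated by `f u * (g v - g u)` up to a superlinear
error is a primitive for the Riemann–Stieltjes integral of `f` against `g`. -/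
lemma hasStieltjesIntegral_of_primitive {f g F : ℝ → ℝ} {A G C β γ a b : ℝ} (hβ : 0 ≤ β)
    (hγ : 0 ≤ γ) (hθ : 1 < β + γ) (hA : 0 ≤ A) (hG : 0 ≤ G) (hC : 0 ≤ C)
    (hf : HolderBound f A β a b) (hg : HolderBound g G γ a b)
    (hF : ∀ u v, a ≤ u → u ≤ v → v ≤ b →
      |F v - F u - f u * (g v - g u)| ≤ C * (v - u) ^ (β + γ)) :
    HasStieltjesIntegral f g a b (F b - F a) := by
  intro ε hε
  have hAG : 0 ≤ A * G := mul_nonneg hA hG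
  have hlim : Tendsto (fun δ : ℝ => (C + A * G) * δ ^ (β + γ - 1) * (b - a)) (𝓝[>] 0) (𝓝 0) := by
    have h1 : ContinuousAt (fun δ : ℝ => δ ^ (β + γ - 1)) 0 :=
      Real.continuousAt_rpow_const _ _ (Or.inr (by linarith))
    have h2 := ((h1.tendsto.const_mul (C + A * G)).mul_const (b - a)).mono_left
      (nhdsWithin_le_nhds (s := Ioi 0))
    rwa [Real.zero_rpow (by linarith), mul_zero, zero_mul] at h2
  obtain ⟨δ, hδε, hδ⟩ := ((hlim.eventually_lt_const hε).and self_mem_nhdsWithin).exists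
  refine ⟨δ, hδ, fun n u τ hu0 hun hu => ?_⟩
  replace hδ : 0 < δ := hδ
  have hmono := fun {i j : ℕ} => le_of_forall_le_succ
    (fun i hi => (hu i hi).1.trans (hu i hi).2.1) (i := i) (j := j)
  have hsum : ∑ i ∈ Finset.range n, f (τ i) * (g (u (i + 1)) - g (u i)) - (F b - F a)
      = ∑ i ∈ Finset.range n,
        (f (τ i) * (g (u (i + 1)) - g (u i)) - (F (u (i + 1)) - F (u i))) := by
    rw [Finset.sum_sub_distrib, Finset.sum_range_sub (fun i => F (u i)), hu0, hun]
  rw [hsum]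
  refine lt_of_le_of_lt ?_ hδε
  have htel : (C + A * G) * δ ^ (β + γ - 1) * (b - a)
      = ∑ i ∈ Finset.range n, (C + A * G) * δ ^ (β + γ - 1) * (u (i + 1) - u i) := by
    rw [← Finset.mul_sum, Finset.sum_range_sub, hu0, hun]
  rw [htel]
  refine (Finset.abs_sum_le_sum_abs _ _).trans (Finset.sum_le_sum fun i hi => ?_)
  rw [Finset.mem_range] at hi
  obtain ⟨h1, h2, h3⟩ := hu i hi
  have ha : a ≤ u i := hu0 ▸ hmono (Nat.zero_le _) hi.le
  have hb : u (i + 1) ≤ b := hun ▸ hmono (i := i + 1) (by omega) le_rfl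
  have e1 := hF (u i) (u (i + 1)) ha (h1.trans h2) hb
  have e2 := HolderBound.abs_mul_le hβ hγ hA hG hf hg (δ := u (i + 1) - u i) ha h1
    (h2.trans hb) ha (h1.trans h2) hb (by linarith) le_rfl
  have h0 : 0 ≤ u (i + 1) - u i := by linarith
  have e3 : (u (i + 1) - u i) ^ (β + γ) ≤ δ ^ (β + γ - 1) * (u (i + 1) - u i) := by
    have : (u (i + 1) - u i) ^ (β + γ)
        = (u (i + 1) - u i) ^ (β + γ - 1) * (u (i + 1) - u i) := by
      conv_lhs => rw [← sub_add_cancel (β + γ) 1,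
        Real.rpow_add_of_nonneg h0 (by linarith) zero_le_one, Real.rpow_one]
    rw [this]
    gcongr
  have e4 := mul_le_mul_of_nonneg_left e3 (add_nonneg hC hAG)
  rw [abs_le] at e1 e2 ⊢
  constructor <;> nlinarith only [e1, e2, e4]

/-- The left-point Riemann–Stieltjes sum of `f` against `g` over the dyadic grid of level `n` of
`[0, T]`, stopped at `t`. -/
noncomputable def dyadicSum (f g : ℝ → ℝ) (T : ℝ) (n : ℕ) (t : ℝ) : ℝ :=
  ∑ i ∈ Finset.range (2 ^ n), f (T * (i : ℝ) / 2 ^ n) *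
    (g (min (T * ((i + 1 : ℕ) : ℝ) / 2 ^ n) t) - g (min (T * (i : ℝ) / 2 ^ n) t))

lemma sum_range_two_mul (a : ℕ → ℝ) (N : ℕ) :
    ∑ i ∈ Finset.range (2 * N), a i = ∑ j ∈ Finset.range N, (a (2 * j) + a (2 * j + 1)) := by
  induction N with
  | zero => simp
  | succ N ih =>
    rw [Finset.sum_range_succ, ← ih, show 2 * (N + 1) = 2 * N + 1 + 1 by ring,
      Finset.sum_range_succ, Finset.sum_range_succ]
    ring

/-- Refinement changes each of the 2^n cells by O((T / 2^n)^(β+γ)), so consecutive levels differ by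
a geometrically small amount. -/
lemma abs_dyadicSum_sub_le {f g : ℝ → ℝ} {A G β γ T : ℝ} (hβ : 0 ≤ β) (hγ : 0 ≤ γ)
    (hA : 0 ≤ A) (hG : 0 ≤ G) (hT : 0 ≤ T)
    (hf : HolderBound f A β 0 T) (hg : HolderBound g G γ 0 T) (n : ℕ) {t : ℝ}
    (ht : t ∈ Icc 0 T) :
    |dyadicSum f g T n t - dyadicSum f g T (n + 1) t|
      ≤ A * G * T ^ (β + γ) * ((2 : ℝ) ^ (1 - (β + γ))) ^ n := by
  have h2 : (0 : ℝ) < 2 ^ n := by positivity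
  unfold dyadicSum
  rw [pow_succ' 2 n, sum_range_two_mul, ← Finset.sum_sub_distrib]
  have hbound : ∀ j ∈ Finset.range (2 ^ n),
      |f (T * (j : ℝ) / 2 ^ n) *
        (g (min (T * ((j + 1 : ℕ) : ℝ) / 2 ^ n) t) - g (min (T * (j : ℝ) / 2 ^ n) t))
      - (f (T * ((2 * j : ℕ) : ℝ) / 2 ^ (n + 1)) *
          (g (min (T * ((2 * j + 1 : ℕ) : ℝ) / 2 ^ (n + 1)) t)
            - g (min (T * ((2 * j : ℕ) : ℝ) / 2 ^ (n + 1)) t))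
        + f (T * ((2 * j + 1 : ℕ) : ℝ) / 2 ^ (n + 1)) *
          (g (min (T * ((2 * j + 1 + 1 : ℕ) : ℝ) / 2 ^ (n + 1)) t)
            - g (min (T * ((2 * j + 1 : ℕ) : ℝ) / 2 ^ (n + 1)) t)))|
      ≤ A * G * (T / 2 ^ n) ^ (β + γ) := by
    intro j hj
    rw [Finset.mem_range] at hj
    have hj' : (j : ℝ) + 1 ≤ 2 ^ n := by exact_mod_cast hj
    have p0 : T * ((2 * j : ℕ) : ℝ) / 2 ^ (n + 1) = T * (j : ℝ) / 2 ^ n := by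
      push_cast; rw [pow_succ]; field_simp
    have p2 : T * ((2 * j + 1 + 1 : ℕ) : ℝ) / 2 ^ (n + 1) = T * ((j + 1 : ℕ) : ℝ) / 2 ^ n := by
      push_cast; rw [pow_succ]; field_simp; ring
    have p1 : T * ((2 * j + 1 : ℕ) : ℝ) / 2 ^ (n + 1) = T * (j : ℝ) / 2 ^ n + T / 2 ^ n / 2 := by
      push_cast; rw [pow_succ]; field_simp
    have p3 : T * ((j + 1 : ℕ) : ℝ) / 2 ^ n = T * (j : ℝ) / 2 ^ n + T / 2 ^ n := by
      push_cast; field_simp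
    have p4 : T * (j : ℝ) / 2 ^ n + T / 2 ^ n ≤ T := by
      rw [← p3, div_le_iff₀ h2]; push_cast; gcongr
    have p5 : 0 ≤ T * (j : ℝ) / 2 ^ n := by positivity
    have p6 : 0 ≤ T / 2 ^ n := by positivity
    rw [p2, p1, p0, p3]
    -- After cancellation a cell contributes only (f(midpoint) − f(left end)) times the increment of
    -- g over its right half, stopped at t.
    have e := HolderBound.abs_mul_le hβ hγ hA hG hf hg (u := T * (j : ℝ) / 2 ^ n)
      (v := T * (j : ℝ) / 2 ^ n + T / 2 ^ n / 2)
      (p := min (T * (j : ℝ) / 2 ^ n + T / 2 ^ n / 2) t)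
      (q := min (T * (j : ℝ) / 2 ^ n + T / 2 ^ n) t) (δ := T / 2 ^ n) p5 (by linarith)
      (by linarith) (le_min (by linarith) ht.1) (min_le_min_right _ (by linarith))
      ((min_le_right _ _).trans ht.2) (by linarith) (by
        rcases le_total t (T * (j : ℝ) / 2 ^ n + T / 2 ^ n / 2) with h | h
        · rw [min_eq_right h, min_eq_right (by linarith)]; linarith
        · rw [min_eq_left h]
          linarith [min_le_left (T * (j : ℝ) / 2 ^ n + T / 2 ^ n) t])
    rw [← abs_neg]
    refine le_of_eq_of_le (congrArg abs ?_) e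
    ring
  refine (Finset.abs_sum_le_sum_abs _ _).trans ((Finset.sum_le_sum hbound).trans_eq ?_)
  rw [Finset.sum_const, Finset.card_range, nsmul_eq_mul, Real.div_rpow hT h2.le,
    ← Real.rpow_natCast (2 ^ (1 - (β + γ))), ← Real.rpow_mul two_pos.le, mul_comm (1 - (β + γ)),
    Real.rpow_mul two_pos.le, Real.rpow_natCast, Real.rpow_sub h2, Real.rpow_one]
  push_cast
  ring

/-- Clamping the grid to [s, t] turns the increment into a left-point sum, to which Young's
inequality applies, except that f is still evaluated at unclamped points. This matters only in the
cell straddling s and produces the last term. -/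
lemma abs_dyadicSum_increment_le {f g : ℝ → ℝ} {A G β γ T : ℝ} (hβ : 0 ≤ β) (hγ : 0 ≤ γ)
    (hθ : 1 < β + γ) (hA : 0 ≤ A) (hG : 0 ≤ G)
    (hf : HolderBound f A β 0 T) (hg : HolderBound g G γ 0 T) (n : ℕ) {s t : ℝ}
    (hs : 0 ≤ s) (hst : s ≤ t) (ht : t ≤ T) :
    |dyadicSum f g T n t - dyadicSum f g T n s - f s * (g t - g s)|
      ≤ youngConst (β + γ) * (A * G) * (t - s) ^ (β + γ) + A * G * (T / 2 ^ n) ^ (β + γ) := by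
  have hT : 0 ≤ T := hs.trans (hst.trans ht)
  have h2 : (0 : ℝ) < 2 ^ n := by positivity
  set p : ℕ → ℝ := fun i => T * (i : ℝ) / 2 ^ n with hp
  set c : ℕ → ℝ := fun i => max s (min (p i) t) with hc
  have hp1 : ∀ i, p (i + 1) = p i + T / 2 ^ n := fun i => by
    simp only [hp]; push_cast; field_simp
  have hpT : 0 ≤ T / 2 ^ n := by positivity
  have hp0 : ∀ i, 0 ≤ p i := fun i => by simp only [hp]; positivity
  have hplast : p (2 ^ n) = T := by simp only [hp]; push_cast; field_simp
  have hc0 : c 0 = s := by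
    have : p 0 = 0 := by simp [hp]
    simp only [hc, this]
    exact max_eq_left ((min_le_left _ _).trans hs)
  have hclast : c (2 ^ n) = t := by
    simp only [hc, hplast, min_eq_right ht, max_eq_right hst]
  have hcmono : ∀ i, c i ≤ c (i + 1) := fun i =>
    max_le_max_left _ (min_le_min_right _ (by linarith [hp1 i]))
  have hcs : ∀ i, s ≤ c i := fun i => le_max_left _ _
  have hct : ∀ i, c i ≤ t := fun i => max_le hst (min_le_right _ _)
  have hclamp : ∀ q : ℝ, g (min q t) - g (min q s) = g (max s (min q t)) - g s := by
    intro q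
    rcases le_total q s with h | h
    · rw [min_eq_left h, min_eq_left (h.trans hst), max_eq_left h]; ring
    · rw [min_eq_right h, max_eq_right (le_min h hst)]
  have hinc : dyadicSum f g T n t - dyadicSum f g T n s
      = ∑ i ∈ Finset.range (2 ^ n), f (p i) * (g (c (i + 1)) - g (c i)) := by
    unfold dyadicSum
    rw [← Finset.sum_sub_distrib]
    refine Finset.sum_congr rfl fun i _ => ?_
    have e1 := hclamp (p (i + 1))
    have e2 := hclamp (p i)
    simp only [hc]
    linear_combination f (p i) * (e1 - e2)
  have hmain := abs_sum_sub_le hβ hγ hθ hA hG hf hg (2 ^ n) c (fun i _ => hcmono i)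
    (hc0 ▸ hs) (hclast ▸ ht)
  rw [hc0, hclast] at hmain
  have herr : |∑ i ∈ Finset.range (2 ^ n), (f (c i) - f (p i)) * (g (c (i + 1)) - g (c i))|
      ≤ A * G * (T / 2 ^ n) ^ (β + γ) := by
    -- The difference φ i − φ (i + 1) is the indicator of the cell straddling s, and its sum
    -- telescopes to at most 1.
    set φ : ℕ → ℝ := fun i => if p i < s then 1 else 0 with hφ
    have hX : 0 ≤ A * G * (T / 2 ^ n) ^ (β + γ) := by positivity
    have hterm : ∀ i ∈ Finset.range (2 ^ n), |(f (c i) - f (p i)) * (g (c (i + 1)) - g (c i))|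
        ≤ A * G * (T / 2 ^ n) ^ (β + γ) * (φ i - φ (i + 1)) := by
      intro i hi
      have hiT : p i ≤ T := by
        rw [Finset.mem_range] at hi
        rw [← hplast]
        simp only [hp]
        gcongr
      by_cases h1 : p i < s
      · have hci : c i = s := max_eq_left ((min_le_left _ _).trans h1.le)
        by_cases h3 : p (i + 1) < s
        · have hci' : c (i + 1) = s := max_eq_left ((min_le_left _ _).trans h3.le)
          simp [hφ, h1, h3, hci, hci']
        · have h4 : c (i + 1) ≤ p (i + 1) := max_le (not_lt.1 h3) (min_le_left _ _)
          simp only [hφ, if_pos h1, if_neg h3, sub_zero, mul_one]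
          have := hp1 i
          exact HolderBound.abs_mul_le hβ hγ hA hG hf hg (hp0 i) (hci ▸ h1.le)
            ((hct i).trans ht) (hs.trans (hcs i)) (hcmono i) ((hct _).trans ht)
            (by linarith [not_lt.1 h3]) (by linarith)
      · have h3 : ¬ p (i + 1) < s := by linarith [hp1 i]
        simp only [hφ, if_neg h1, if_neg h3, sub_zero, mul_zero]
        rcases le_total (p i) t with h4 | h4
        · have : c i = p i := by
            simp only [hc, min_eq_left h4, max_eq_right (not_lt.1 h1)]
          simp [this]
        · have e1 : c i = t := by simp only [hc, min_eq_right h4, max_eq_right hst]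
          have e2 : c (i + 1) = t := le_antisymm (hct _) (e1 ▸ hcmono i)
          simp [e1, e2]
    refine (Finset.abs_sum_le_sum_abs _ _).trans ((Finset.sum_le_sum hterm).trans ?_)
    rw [← Finset.mul_sum, Finset.sum_range_sub']
    refine mul_le_of_le_one_right hX ?_
    have h5 : φ 0 ≤ 1 := by simp only [hφ]; split_ifs <;> norm_num
    have h6 : 0 ≤ φ (2 ^ n) := by simp only [hφ]; split_ifs <;> norm_num
    linarith
  have hsplit : dyadicSum f g T n t - dyadicSum f g T n s - f s * (g t - g s)
      = (∑ i ∈ Finset.range (2 ^ n), f (c i) * (g (c (i + 1)) - g (c i)) - f s * (g t - g s))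
        - ∑ i ∈ Finset.range (2 ^ n), (f (c i) - f (p i)) * (g (c (i + 1)) - g (c i)) := by
    rw [hinc]
    have : ∀ i ∈ Finset.range (2 ^ n), (f (c i) - f (p i)) * (g (c (i + 1)) - g (c i))
        = f (c i) * (g (c (i + 1)) - g (c i)) - f (p i) * (g (c (i + 1)) - g (c i)) :=
      fun i _ => by ring
    rw [Finset.sum_congr rfl this, Finset.sum_sub_distrib]
    ring
  rw [hsplit]
  exact (abs_sub _ _).trans (add_le_add hmain herr)

/-- Existence of the Young integral as a Riemann–Stieltjes integral. -/
theorem exists_primitive {f g : ℝ → ℝ} {A G β γ T : ℝ} (hβ : 0 ≤ β) (hγ : 0 ≤ γ)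
    (hθ : 1 < β + γ) (hA : 0 ≤ A) (hG : 0 ≤ G) (hT : 0 ≤ T)
    (hf : HolderBound f A β 0 T) (hg : HolderBound g G γ 0 T) :
    ∃ F : ℝ → ℝ, ∀ s t, 0 ≤ s → s ≤ t → t ≤ T →
      HasStieltjesIntegral f g s t (F t - F s) := by
  have hlim : ∀ t, ∃ l, t ∈ Icc 0 T → Tendsto (fun n => dyadicSum f g T n t) atTop (𝓝 l) := by
    intro t
    by_cases ht : t ∈ Icc 0 T
    · have hcs : CauchySeq (fun n => dyadicSum f g T n t) := by
        refine cauchySeq_of_le_geometric _ (A * G * T ^ (β + γ)) (two_rpow_lt_one hθ) fun n => ?_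
        rw [Real.dist_eq]
        exact abs_dyadicSum_sub_le hβ hγ hA hG hT hf hg n ht
      obtain ⟨l, hl⟩ := cauchySeq_tendsto_of_complete hcs
      exact ⟨l, fun _ => hl⟩
    · exact ⟨0, fun h => absurd h ht⟩
  choose F hF using hlim
  have hK := youngConst_pos hθ
  have hinc : ∀ u v, 0 ≤ u → u ≤ v → v ≤ T →
      |F v - F u - f u * (g v - g u)| ≤ youngConst (β + γ) * (A * G) * (v - u) ^ (β + γ) := by
    intro u v hu huv hv
    have h1 := ((((hF v ⟨hu.trans huv, hv⟩).sub (hF u ⟨hu, huv.trans hv⟩)).sub_const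
      (f u * (g v - g u))).abs)
    have h2 : Tendsto (fun n : ℕ => youngConst (β + γ) * (A * G) * (v - u) ^ (β + γ)
        + A * G * (T / 2 ^ n) ^ (β + γ)) atTop
        (𝓝 (youngConst (β + γ) * (A * G) * (v - u) ^ (β + γ) + A * G * 0 ^ (β + γ))) := by
      have h3 : Tendsto (fun n : ℕ => T / (2 : ℝ) ^ n) atTop (𝓝 0) :=
        Tendsto.div_atTop tendsto_const_nhds (tendsto_pow_atTop_atTop_of_one_lt one_lt_two)
      exact ((h3.rpow_const (Or.inr (by linarith))).const_mul _).const_add _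
    rw [Real.zero_rpow (by linarith), mul_zero, add_zero] at h2
    exact le_of_tendsto_of_tendsto' h1 h2
      (fun n => abs_dyadicSum_increment_le hβ hγ hθ hA hG hf hg n hu huv hv)
  refine ⟨F, fun s t hs hst ht => ?_⟩
  exact hasStieltjesIntegral_of_primitive hβ hγ hθ hA hG (by positivity) (hf.mono hs ht)
    (hg.mono hs ht) (fun u v hu huv hv => hinc u v (hs.trans hu) huv (hv.trans ht))

/-! ### Uniqueness and size of the integral -/

/-- Every interval has uniform partitions of arbitrarily small mesh. -/
lemma exists_partition {s t δ : ℝ} (hst : s ≤ t) (hδ : 0 < δ) :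
    ∃ (n : ℕ) (u : ℕ → ℝ), u 0 = s ∧ u n = t ∧ ∀ i < n, u i ≤ u (i + 1) ∧ u (i + 1) - u i < δ := by
  obtain ⟨n, hn⟩ := exists_nat_gt ((t - s) / δ)
  have hn0 : (0 : ℝ) < n := lt_of_le_of_lt (div_nonneg (by linarith) hδ.le) hn
  have hstep : ∀ i : ℕ, s + (t - s) * ((i + 1 : ℕ) : ℝ) / n - (s + (t - s) * i / n) = (t - s) / n :=
    fun i => by push_cast; field_simp; ring
  refine ⟨n, fun i => s + (t - s) * i / n, by simp, by field_simp; ring, fun i _ => ⟨?_, ?_⟩⟩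
  · have : 0 ≤ (t - s) / n := div_nonneg (by linarith) hn0.le
    linarith [hstep i]
  · dsimp only
    rw [hstep, div_lt_iff₀ hn0]
    rw [div_lt_iff₀ hδ] at hn
    linarith

/-- The order s ≤ t is essential: for s > t there are no admissible partitions and every number
would be an integral. -/
lemma HasStieltjesIntegral.unique {f g : ℝ → ℝ} {s t I J : ℝ} (hst : s ≤ t)
    (hI : HasStieltjesIntegral f g s t I) (hJ : HasStieltjesIntegral f g s t J) : I = J := by
  by_contra hne
  have hε : 0 < |I - J| / 2 := by have := abs_pos.2 (sub_ne_zero.2 hne); linarith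
  obtain ⟨δ₁, h1, H1⟩ := hI _ hε
  obtain ⟨δ₂, h2, H2⟩ := hJ _ hε
  obtain ⟨n, u, hu0, hun, hu⟩ := exists_partition hst (lt_min h1 h2)
  have k1 := H1 n u u hu0 hun fun i hi =>
    ⟨le_rfl, (hu i hi).1, (hu i hi).2.trans_le (min_le_left _ _)⟩
  have k2 := H2 n u u hu0 hun fun i hi =>
    ⟨le_rfl, (hu i hi).1, (hu i hi).2.trans_le (min_le_right _ _)⟩
  have := abs_sub_le I (∑ i ∈ Finset.range n, f (u i) * (g (u (i + 1)) - g (u i))) J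
  rw [abs_sub_comm I (∑ i ∈ _, _)] at this
  linarith

lemma HasStieltjesIntegral.sub {f₁ f₂ g : ℝ → ℝ} {s t I J : ℝ}
    (hI : HasStieltjesIntegral f₁ g s t I) (hJ : HasStieltjesIntegral f₂ g s t J) :
    HasStieltjesIntegral (fun τ => f₁ τ - f₂ τ) g s t (I - J) := by
  intro ε hε
  obtain ⟨δ₁, h1, H1⟩ := hI _ (half_pos hε)
  obtain ⟨δ₂, h2, H2⟩ := hJ _ (half_pos hε)
  refine ⟨min δ₁ δ₂, lt_min h1 h2, fun n u τ hu0 hun hu => ?_⟩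
  have k1 := H1 n u τ hu0 hun fun i hi =>
    ⟨(hu i hi).1, (hu i hi).2.1, (hu i hi).2.2.trans_le (min_le_left _ _)⟩
  have k2 := H2 n u τ hu0 hun fun i hi =>
    ⟨(hu i hi).1, (hu i hi).2.1, (hu i hi).2.2.trans_le (min_le_right _ _)⟩
  simp only [sub_mul, Finset.sum_sub_distrib]
  rw [abs_lt] at k1 k2 ⊢
  constructor <;> linarith

/-- Young's estimate of the Riemann–Stieltjes integral. -/
theorem HasStieltjesIntegral.abs_sub_le {f g : ℝ → ℝ} {A G β γ s t I : ℝ} (hβ : 0 ≤ β)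
    (hγ : 0 ≤ γ) (hθ : 1 < β + γ) (hA : 0 ≤ A) (hG : 0 ≤ G) (hst : s ≤ t)
    (hf : HolderBound f A β s t) (hg : HolderBound g G γ s t)
    (hI : HasStieltjesIntegral f g s t I) :
    |I - f s * (g t - g s)| ≤ youngConst (β + γ) * (A * G) * (t - s) ^ (β + γ) := by
  refine le_of_forall_pos_le_add fun ε hε => ?_
  obtain ⟨δ, hδ, H⟩ := hI ε hε
  obtain ⟨n, u, hu0, hun, hu⟩ := exists_partition hst hδ
  have k1 := H n u u hu0 hun fun i hi => ⟨le_rfl, (hu i hi).1, (hu i hi).2⟩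
  have k2 := abs_sum_sub_le hβ hγ hθ hA hG hf hg n u (fun i hi => (hu i hi).1) hu0.ge hun.le
  rw [hu0, hun] at k2
  rw [abs_lt] at k1
  rw [abs_le] at k2 ⊢
  constructor <;> linarith

/-! ### The exponentially weighted Hölder bound -/

/-- Local Hölder continuity on `[0, T]` at scale `h`, with an exponential weight. -/
def WeightedBound (d : ℝ → ℝ) (M β h T : ℝ) : Prop :=
  ∀ s t, 0 ≤ s → s ≤ t → t ≤ T → t - s ≤ h → |d t - d s| ≤ M * Real.exp (t / h) * (t - s) ^ β

lemma exp_neg_one_le_half : Real.exp (-1) ≤ 1 / 2 := by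
  rw [Real.exp_neg, one_div]
  exact inv_anti₀ two_pos (by linarith [Real.add_one_le_exp 1])

/-- A step back by h multiplies the weight by exp(−1) ≤ 1/2, so the increments over successive steps
sum to at most twice the last one. -/
lemma WeightedBound.abs_sub_zero_le {d : ℝ → ℝ} {M β h T : ℝ} (hβ : 0 ≤ β) (hM : 0 ≤ M)
    (hh : 0 < h) (hd : WeightedBound d M β h T) {t : ℝ} (ht : t ∈ Icc 0 T) :
    |d t - d 0| ≤ 2 * M * h ^ β * Real.exp (t / h) := by
  have key : ∀ n : ℕ, ∀ t ∈ Icc 0 T, t ≤ n * h →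
      |d t - d 0| ≤ 2 * M * h ^ β * Real.exp (t / h) := by
    intro n
    induction n with
    | zero =>
      intro t ht htn
      have : t = 0 := le_antisymm (by simpa using htn) ht.1
      subst this
      simp only [sub_self, abs_zero]
      positivity
    | succ n ih =>
      intro t ht htn
      have hnn : 0 ≤ M * h ^ β * Real.exp (t / h) := by positivity
      rcases le_total t h with h1 | h1
      · refine (hd 0 t le_rfl ht.1 ht.2 (by linarith)).trans ?_
        have : M * Real.exp (t / h) * (t - 0) ^ β ≤ M * Real.exp (t / h) * h ^ β := by
          rw [sub_zero]
          have := ht.1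
          gcongr
        linarith
      · have e1 := ih (t - h) ⟨by linarith, by linarith [ht.2]⟩ (by push_cast at htn; linarith)
        have e2 := hd (t - h) t (by linarith) (by linarith) ht.2 (by linarith)
        rw [show t - (t - h) = h by ring] at e2
        have e3 : Real.exp ((t - h) / h) = Real.exp (t / h) * Real.exp (-1) := by
          rw [← Real.exp_add]
          congr 1
          field_simp
          ring
        have e4 := mul_le_mul_of_nonneg_left exp_neg_one_le_half hnn
        rw [e3] at e1
        have := abs_sub_le (d t) (d (t - h)) (d 0)
        linarith
  obtain ⟨n, hn⟩ := exists_nat_ge (t / h)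
  exact key n t ht (by rwa [div_le_iff₀ hh] at hn)

/-- Lags longer than h are split at time 0; each half costs a factor 2, whence the 4. -/
lemma WeightedBound.holderBound {d : ℝ → ℝ} {M β h T : ℝ} (hβ : 0 ≤ β) (hM : 0 ≤ M)
    (hh : 0 < h) (hd : WeightedBound d M β h T) :
    HolderBound d (4 * M * Real.exp (T / h)) β 0 T := by
  intro s t hs hst ht
  have hts : 0 ≤ t - s := by linarith
  rcases le_total (t - s) h with h1 | h1
  · refine (hd s t hs hst ht h1).trans ?_
    have : M * Real.exp (t / h) ≤ M * Real.exp (T / h) := by gcongr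
    gcongr
    have : 0 ≤ M * Real.exp (T / h) := by positivity
    linarith
  · have e1 := hd.abs_sub_zero_le hβ hM hh ⟨hs, hst.trans ht⟩
    have e2 := hd.abs_sub_zero_le hβ hM hh ⟨hs.trans hst, ht⟩
    have e3 : 2 * M * h ^ β * Real.exp (s / h) ≤ 2 * M * (t - s) ^ β * Real.exp (T / h) := by
      gcongr; linarith
    have e4 : 2 * M * h ^ β * Real.exp (t / h) ≤ 2 * M * (t - s) ^ β * Real.exp (T / h) := by
      gcongr
    have := abs_sub_le (d t) (d 0) (d s)
    rw [abs_sub_comm (d 0)] at this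
    linarith

lemma WeightedBound.holderBound_local {d : ℝ → ℝ} {M β h T s t : ℝ} (hM : 0 ≤ M) (hh : 0 < h)
    (hd : WeightedBound d M β h T) (hs : 0 ≤ s) (ht : t ≤ T) (hts : t - s ≤ h) :
    HolderBound d (M * Real.exp (t / h)) β s t := by
  intro u v hu huv hv
  refine (hd u v (by linarith) huv (by linarith) (by linarith)).trans ?_
  have : 0 ≤ v - u := by linarith
  gcongr

lemma HolderBound.weightedBound {d : ℝ → ℝ} {M β h T : ℝ} (hM : 0 ≤ M) (hh : 0 < h)
    (hd : HolderBound d M β 0 T) : WeightedBound d M β h T := by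
  intro s t hs hst ht _
  refine (hd s t hs hst ht).trans ?_
  have : 0 ≤ t - s := by linarith
  gcongr
  refine le_mul_of_one_le_right hM (Real.one_le_exp ?_)
  have : 0 ≤ t := by linarith
  positivity

/-! ### Coefficients along Hölder curves -/

/-- Joint Lipschitz bound in real form on the half plane `t ≥ 0`. -/
def JointLipschitz (h : ℝ → ℝ → ℝ) (L : ℝ) : Prop :=
  ∀ s t x y, 0 ≤ s → 0 ≤ t → |h t x - h s y| ≤ L * (|t - s| + |x - y|)

lemma GloballyLipschitz.exists_jointLipschitz {h : ℝ → ℝ → ℝ} (hh : GloballyLipschitz h) :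
    ∃ L, 0 ≤ L ∧ JointLipschitz h L := by
  obtain ⟨C, hC⟩ := hh
  refine ⟨C, C.2, fun s t x y hs ht => ?_⟩
  have := hC.dist_le_mul (t, x) ⟨ht, mem_univ _⟩ (s, y) ⟨hs, mem_univ _⟩
  rw [Prod.dist_eq, Real.dist_eq, Real.dist_eq, Real.dist_eq] at this
  refine this.trans ?_
  gcongr
  exact max_le_add_of_nonneg (abs_nonneg _) (abs_nonneg _)

lemma JointLipschitz.mono {h : ℝ → ℝ → ℝ} {L L' : ℝ} (hh : JointLipschitz h L) (hL : L ≤ L') :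
    JointLipschitz h L' :=
  fun s t x y hs ht => (hh s t x y hs ht).trans (by gcongr)

lemma le_rpow_of_le_one {r β : ℝ} (h0 : 0 ≤ r) (h1 : r ≤ 1) (hβ : 0 < β) (hβ1 : β ≤ 1) :
    r ≤ r ^ β := by
  rcases h0.eq_or_lt with rfl | h0
  · rw [Real.zero_rpow hβ.ne']
  · conv_lhs => rw [← Real.rpow_one r]
    exact Real.rpow_le_rpow_of_exponent_ge h0 h1 hβ1

/-- On length at most 1 the time increment is below its β-th power. The constant is affine in A and
free of T, so the exponential weight can absorb it. -/
lemma JointLipschitz.holderBound_comp {h : ℝ → ℝ → ℝ} {L : ℝ} (hL : 0 ≤ L)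
    (hh : JointLipschitz h L) {x : ℝ → ℝ} {A β s t : ℝ} (hβ : 0 < β) (hβ1 : β ≤ 1) (hs : 0 ≤ s)
    (hts : t - s ≤ 1) (hx : HolderBound x A β s t) :
    HolderBound (fun τ => h τ (x τ)) (L * (1 + A)) β s t := by
  intro u v hu huv hv
  refine (hh u v (x v) (x u) (by linarith) (by linarith)).trans ?_
  have h1 := hx u v hu huv hv
  have h2 := le_rpow_of_le_one (r := v - u) (by linarith) (by linarith) hβ hβ1
  rw [abs_of_nonneg (by linarith : 0 ≤ v - u), mul_assoc]
  gcongr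
  linarith

lemma JointLipschitz.holderBound_comp_of_le {h : ℝ → ℝ → ℝ} {L : ℝ} (hL : 0 ≤ L)
    (hh : JointLipschitz h L) {x : ℝ → ℝ} {A β T : ℝ} (hβ : 0 < β) (hβ1 : β ≤ 1) (hT : 0 ≤ T)
    (hx : HolderBound x A β 0 T) :
    HolderBound (fun τ => h τ (x τ)) (L * (1 + T + A)) β 0 T := by
  intro u v hu huv hv
  refine (hh u v (x v) (x u) (by linarith) (by linarith)).trans ?_
  have h1 := hx u v hu huv hv
  have h0 : 0 ≤ v - u := by linarith
  have hp : 0 ≤ (v - u) ^ β := Real.rpow_nonneg h0 _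
  rw [abs_of_nonneg h0, mul_assoc]
  gcongr
  rcases le_total (v - u) 1 with h2 | h2
  · have h3 := le_rpow_of_le_one h0 h2 hβ hβ1
    have := mul_nonneg hT hp
    linarith
  · have h3 := Real.one_le_rpow h2 hβ.le
    have := mul_le_mul_of_nonneg_left h3 hT
    linarith

lemma HolderBound.continuousOn {f : ℝ → ℝ} {A β a b : ℝ} (hβ : 0 < β)
    (hf : HolderBound f A β a b) : ContinuousOn f (Icc a b) := by
  intro u hu
  have hb : ∀ v ∈ Icc a b, dist (f v) (f u) ≤ A * |v - u| ^ β := by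
    intro v hv
    rw [Real.dist_eq]
    rcases le_total u v with h | h
    · rw [abs_of_nonneg (by linarith : 0 ≤ v - u)]
      exact hf u v hu.1 h hv.2
    · rw [abs_sub_comm, abs_sub_comm v, abs_of_nonneg (by linarith : 0 ≤ u - v)]
      exact hf v u hv.1 h hu.2
  have hlim : Tendsto (fun v => A * |v - u| ^ β) (𝓝[Icc a b] u) (𝓝 0) := by
    have h1 : ContinuousAt (fun v : ℝ => A * |v - u| ^ β) u := by
      refine continuousAt_const.mul (ContinuousAt.rpow_const (by fun_prop) (Or.inr hβ.le))
    have := h1.tendsto.mono_left (nhdsWithin_le_nhds (s := Icc a b))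
    simpa [Real.zero_rpow hβ.ne'] using this
  exact tendsto_iff_dist_tendsto_zero.2 (squeeze_zero' (Eventually.of_forall fun _ => dist_nonneg)
    (eventually_nhdsWithin_of_forall hb) hlim)

/-- The difference of a function along two curves, when its `x`-derivative is bounded and
Lipschitz. -/
lemma abs_four_point_le {σ σ' : ℝ → ℝ → ℝ} {L : ℝ} (hL : 0 ≤ L)
    (hd : ∀ t x, 0 ≤ t → HasDerivAt (σ t) (σ' t x) x) (hb : ∀ t x, 0 ≤ t → |σ' t x| ≤ L)
    (hlip : JointLipschitz σ' L) {u v : ℝ} (hu : 0 ≤ u) (hv : 0 ≤ v) (x₁ x₂ y₁ y₂ : ℝ) :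
    |(σ v x₂ - σ v y₂) - (σ u x₁ - σ u y₁)| ≤
      L * |(x₂ - y₂) - (x₁ - y₁)|
        + L * (|v - u| + (|x₂ - x₁| + |y₂ - y₁|)) * |x₁ - y₁| := by
  -- Moving from the y's to the x's along straight segments makes the four-point difference the
  -- increment of one function over [0, 1].
  have hder : ∀ r ∈ Icc (0 : ℝ) 1, HasDerivWithinAt
      (fun r => σ v (y₂ + r * (x₂ - y₂)) - σ u (y₁ + r * (x₁ - y₁)))
      (σ' v (y₂ + r * (x₂ - y₂)) * (x₂ - y₂) - σ' u (y₁ + r * (x₁ - y₁)) * (x₁ - y₁))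
      (Icc 0 1) r := by
    intro r _
    have hline : ∀ p q : ℝ, HasDerivAt (fun r : ℝ => p + r * q) q r := fun p q => by
      simpa using ((hasDerivAt_id r).mul_const q).const_add p
    exact (((hd v _ hv).comp r (hline y₂ (x₂ - y₂))).sub
      ((hd u _ hu).comp r (hline y₁ (x₁ - y₁)))).hasDerivWithinAt
  have hbound : ∀ r ∈ Ico (0 : ℝ) 1,
      ‖σ' v (y₂ + r * (x₂ - y₂)) * (x₂ - y₂) - σ' u (y₁ + r * (x₁ - y₁)) * (x₁ - y₁)‖
        ≤ L * |(x₂ - y₂) - (x₁ - y₁)|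
          + L * (|v - u| + (|x₂ - x₁| + |y₂ - y₁|)) * |x₁ - y₁| := by
    intro r hr
    set p := y₂ + r * (x₂ - y₂)
    set q := y₁ + r * (x₁ - y₁)
    have hpq : |p - q| ≤ |x₂ - x₁| + |y₂ - y₁| := by
      have : p - q = r * (x₂ - x₁) + (1 - r) * (y₂ - y₁) := by simp only [p, q]; ring
      rw [this]
      refine (abs_add_le _ _).trans ?_
      rw [abs_mul, abs_mul, abs_of_nonneg hr.1, abs_of_nonneg (by linarith [hr.2] : 0 ≤ 1 - r)]
      have := mul_le_mul_of_nonneg_right hr.2.le (abs_nonneg (x₂ - x₁))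
      have := mul_nonneg hr.1 (abs_nonneg (y₂ - y₁))
      linarith
    rw [Real.norm_eq_abs, show σ' v p * (x₂ - y₂) - σ' u q * (x₁ - y₁)
      = σ' v p * ((x₂ - y₂) - (x₁ - y₁)) + (σ' v p - σ' u q) * (x₁ - y₁) by ring]
    refine (abs_add_le _ _).trans ?_
    rw [abs_mul, abs_mul]
    have h1 := hb v p hv
    have h2 := (hlip u v p q hu hv).trans
      (mul_le_mul_of_nonneg_left (add_le_add_right hpq |v - u|) hL)
    gcongr
  have := norm_image_sub_le_of_norm_deriv_le_segment_01' hder hbound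
  simp only [one_mul, zero_mul, add_zero, add_sub_cancel, Real.norm_eq_abs] at this
  convert this using 2
  ring

/-! ### Short-interval estimate and the Picard map -/

/-- Increment estimate for a drift integral plus a Young integral over a short interval. -/
lemma abs_integral_add_le {ψ φ g : ℝ → ℝ} {P P' Q G β γ h s t I : ℝ} (hβ : 0 < β)
    (hβγ : β < γ) (hγ1 : γ ≤ 1) (hθ : 1 < β + γ) (hP' : 0 ≤ P') (hQ : 0 ≤ Q)
    (hG : 0 ≤ G) (hst : s ≤ t) (hts : t - s ≤ h) (hh1 : h ≤ 1)
    (hψ : ∀ τ ∈ Icc s t, |ψ τ| ≤ P') (hφs : |φ s| ≤ P) (hφ : HolderBound φ Q β s t)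
    (hg : HolderBound g G γ s t) (hI : HasStieltjesIntegral φ g s t I) :
    |(∫ τ in s..t, ψ τ) + I|
      ≤ (P' + (P + youngConst (β + γ) * Q) * G) * h ^ (γ - β) * (t - s) ^ β := by
  have h0 : 0 ≤ t - s := by linarith
  have hK := youngConst_pos hθ
  have hP : 0 ≤ P := (abs_nonneg _).trans hφs
  have hpow : (t - s) ^ γ ≤ h ^ (γ - β) * (t - s) ^ β := by
    have : (t - s) ^ γ = (t - s) ^ (γ - β) * (t - s) ^ β := by
      rw [← Real.rpow_add_of_nonneg h0 (by linarith) hβ.le, sub_add_cancel]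
    rw [this]
    have : (t - s) ^ (γ - β) ≤ h ^ (γ - β) :=
      Real.rpow_le_rpow h0 hts (by linarith)
    gcongr
  have hpow1 : t - s ≤ h ^ (γ - β) * (t - s) ^ β :=
    (le_rpow_of_le_one h0 (by linarith) (by linarith) hγ1).trans hpow
  have hpow2 : (t - s) ^ (β + γ) ≤ h ^ (γ - β) * (t - s) ^ β := by
    rw [Real.rpow_add_of_nonneg h0 hβ.le (by linarith)]
    refine (mul_le_of_le_one_left (by positivity) ?_).trans hpow
    exact Real.rpow_le_one h0 (by linarith) hβ.le
  have e1 : |∫ τ in s..t, ψ τ| ≤ P' * (t - s) := by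
    have := intervalIntegral.norm_integral_le_of_norm_le_const (a := s) (b := t) (f := ψ) (C := P')
      (fun τ hτ => by
        rw [uIoc_of_le hst] at hτ
        exact hψ τ ⟨hτ.1.le, hτ.2⟩)
    rwa [abs_of_nonneg h0] at this
  have e2 := hI.abs_sub_le hβ.le (by linarith) hθ hQ hG hst hφ hg
  have e3 : |φ s * (g t - g s)| ≤ P * (G * (t - s) ^ γ) := by
    rw [abs_mul]
    have := hg s t le_rfl hst le_rfl
    gcongr
  have f1 := mul_le_mul_of_nonneg_left hpow1 hP'
  have f2 := mul_le_mul_of_nonneg_left hpow2 (by positivity : 0 ≤ youngConst (β + γ) * (Q * G))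
  have f3 := mul_le_mul_of_nonneg_left hpow (mul_nonneg hP hG)
  rw [abs_le] at e1 e2 e3 ⊢
  constructor <;> nlinarith only [e1, e2, e3, f1, f2, f3]

/-- On `[0, T]`, `y` is the image of `x` under the Picard map of the equation. -/
def IsPicardStep (b σ : ℝ → ℝ → ℝ) (g : ℝ → ℝ) (x₀ T : ℝ) (x y : ℝ → ℝ) : Prop :=
  ∀ t ∈ Icc 0 T, ∃ I, HasStieltjesIntegral (fun τ => σ τ (x τ)) g 0 t I ∧
    y t = x₀ + (∫ τ in (0 : ℝ)..t, b τ (x τ)) + I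

lemma HasStieltjesIntegral.zero_self (f g : ℝ → ℝ) (a : ℝ) : HasStieltjesIntegral f g a a 0 := by
  intro ε hε
  refine ⟨1, one_pos, fun n u τ hu0 hun hu => ?_⟩
  have hmono := fun {i j : ℕ} => le_of_forall_le_succ
    (fun i hi => (hu i hi).1.trans (hu i hi).2.1) (i := i) (j := j)
  have hc : ∀ i ≤ n, u i = a := fun i hi =>
    le_antisymm (hun ▸ hmono hi le_rfl) (hu0 ▸ hmono (Nat.zero_le _) hi)
  rw [Finset.sum_eq_zero fun i hi => ?_]
  · simpa using hε
  · rw [Finset.mem_range] at hi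
    rw [hc i hi.le, hc (i + 1) hi, sub_self, mul_zero]

lemma IsPicardStep.apply_zero {b σ : ℝ → ℝ → ℝ} {g x y : ℝ → ℝ} {x₀ T : ℝ} (hT : 0 ≤ T)
    (h : IsPicardStep b σ g x₀ T x y) : y 0 = x₀ := by
  obtain ⟨I, hI, hy⟩ := h 0 ⟨le_rfl, hT⟩
  rw [hy, hI.unique le_rfl (.zero_self _ _ _)]
  simp

section Picard

variable {b σ : ℝ → ℝ → ℝ} {g x : ℝ → ℝ} {x₀ T L A G β γ : ℝ}

lemma intervalIntegrable_drift (hL : 0 ≤ L) (hb : JointLipschitz b L) (hβ : 0 < β) (hβ1 : β ≤ 1)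
    (hx : HolderBound x A β 0 T) {s t : ℝ} (hs : s ∈ Icc 0 T) (ht : t ∈ Icc 0 T) :
    IntervalIntegrable (fun τ => b τ (x τ)) MeasureTheory.volume s t := by
  refine ContinuousOn.intervalIntegrable (ContinuousOn.mono
    ((hb.holderBound_comp_of_le hL hβ hβ1 (hs.1.trans hs.2) hx).continuousOn hβ) ?_)
  exact uIcc_subset_Icc hs ht

lemma exists_isPicardStep (hL : 0 ≤ L) (hσ : JointLipschitz σ L) (hβ : 0 < β) (hβ1 : β ≤ 1)
    (hγ : 0 ≤ γ) (hθ : 1 < β + γ) (hA : 0 ≤ A) (hG : 0 ≤ G) (hT : 0 ≤ T)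
    (hg : HolderBound g G γ 0 T) (hx : HolderBound x A β 0 T) :
    ∃ y, IsPicardStep b σ g x₀ T x y := by
  obtain ⟨F, hF⟩ := exists_primitive hβ.le hγ hθ (by positivity) hG hT
    (hσ.holderBound_comp_of_le hL hβ hβ1 hT hx) hg
  exact ⟨fun t => x₀ + (∫ τ in (0 : ℝ)..t, b τ (x τ)) + (F t - F 0),
    fun t ht => ⟨_, hF 0 t le_rfl ht.1 ht.2, rfl⟩⟩

/-- A single primitive gives the integral over every subinterval, so uniqueness of the integral
yields additivity. -/
lemma IsPicardStep.exists_increment (hL : 0 ≤ L) (hb : JointLipschitz b L)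
    (hσ : JointLipschitz σ L) (hβ : 0 < β) (hβ1 : β ≤ 1)
    (hγ : 0 ≤ γ) (hθ : 1 < β + γ) (hA : 0 ≤ A) (hG : 0 ≤ G)
    (hg : HolderBound g G γ 0 T) (hx : HolderBound x A β 0 T) {y : ℝ → ℝ}
    (hxy : IsPicardStep b σ g x₀ T x y) {s t : ℝ} (hs : 0 ≤ s) (hst : s ≤ t) (ht : t ≤ T) :
    ∃ I, HasStieltjesIntegral (fun τ => σ τ (x τ)) g s t I ∧
      y t - y s = (∫ τ in s..t, b τ (x τ)) + I := by
  have hT : 0 ≤ T := hs.trans (hst.trans ht)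
  have h0 : (0 : ℝ) ∈ Icc 0 T := ⟨le_rfl, hT⟩
  have hs' : s ∈ Icc 0 T := ⟨hs, hst.trans ht⟩
  have ht' : t ∈ Icc 0 T := ⟨hs.trans hst, ht⟩
  obtain ⟨F, hF⟩ := exists_primitive hβ.le hγ hθ (by positivity) hG hT
    (hσ.holderBound_comp_of_le hL hβ hβ1 hT hx) hg
  obtain ⟨I₁, h1, e1⟩ := hxy s hs'
  obtain ⟨I₂, h2, e2⟩ := hxy t ht'
  have k1 := h1.unique hs (hF 0 s le_rfl hs hs'.2)
  have k2 := h2.unique ht'.1 (hF 0 t le_rfl ht'.1 ht)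
  refine ⟨_, hF s t hs hst ht, ?_⟩
  rw [← intervalIntegral.integral_interval_sub_left
    (intervalIntegrable_drift hL hb hβ hβ1 hx h0 ht')
    (intervalIntegrable_drift hL hb hβ hβ1 hx h0 hs'), e1, e2, k1, k2]
  ring

/-- The Picard map preserves the weighted unit ball at a small scale. -/
theorem IsPicardStep.weightedBound (hL : 0 ≤ L) (hb : JointLipschitz b L)
    (hσ : JointLipschitz σ L) (hβ : 0 < β) (hβγ : β < γ) (hγ1 : γ ≤ 1) (hθ : 1 < β + γ)
    (hG : 0 ≤ G) (hg : HolderBound g G γ 0 T) {B h : ℝ} (hh : 0 < h) (hh1 : h ≤ 1) (hB : 0 ≤ B)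
    (hbB : ∀ t ∈ Icc 0 T, |b t x₀| ≤ B) (hσB : ∀ t ∈ Icc 0 T, |σ t x₀| ≤ B)
    (hsmall : (B + 2 * L + (B + 2 * L + youngConst (β + γ) * (2 * L)) * G) * h ^ (γ - β) ≤ 1)
    (hx0 : x 0 = x₀) (hx : WeightedBound x 1 β h T) {y : ℝ → ℝ}
    (hxy : IsPicardStep b σ g x₀ T x y) : WeightedBound y 1 β h T := by
  intro s t hs hst ht hts
  obtain ⟨I, hI, hinc⟩ := hxy.exists_increment hL hb hσ hβ (by linarith) (by linarith) hθ
    (by positivity) hG hg (hx.holderBound hβ.le zero_le_one hh) hs hst ht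
  set E := Real.exp (t / h) with hE
  have hE1 : 1 ≤ E := Real.one_le_exp (div_nonneg (hs.trans hst) hh.le)
  have hsup : ∀ τ ∈ Icc s t, |x τ - x₀| ≤ 2 * E := by
    intro τ hτ
    have := hx.abs_sub_zero_le hβ.le zero_le_one hh (t := τ)
      ⟨hs.trans hτ.1, hτ.2.trans ht⟩
    rw [hx0] at this
    refine this.trans ?_
    have e1 : h ^ β ≤ 1 := Real.rpow_le_one hh.le hh1 hβ.le
    have e2 : Real.exp (τ / h) ≤ E := by
      rw [hE]; have := hτ.2; gcongr
    calc 2 * 1 * h ^ β * Real.exp (τ / h) ≤ 2 * 1 * 1 * E := by gcongr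
      _ = _ := by ring
  have hval : ∀ k : ℝ → ℝ → ℝ, JointLipschitz k L → (∀ t ∈ Icc 0 T, |k t x₀| ≤ B) →
      ∀ τ ∈ Icc s t, |k τ (x τ)| ≤ (B + 2 * L) * E := by
    intro k hk hkB τ hτ
    have h1 := hk τ τ (x τ) x₀ (hs.trans hτ.1) (hs.trans hτ.1)
    have h2 := hkB τ ⟨hs.trans hτ.1, hτ.2.trans ht⟩
    have h3 := mul_le_mul_of_nonneg_left (hsup τ hτ) hL
    have h4 := mul_le_mul_of_nonneg_left hE1 hB
    rw [sub_self, abs_zero, zero_add] at h1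
    have := abs_sub_abs_le_abs_sub (k τ (x τ)) (k τ x₀)
    linarith
  have hφ : HolderBound (fun τ => σ τ (x τ)) (2 * L * E) β s t := by
    have h1 := hσ.holderBound_comp hL hβ (by linarith) hs (by linarith)
      (hx.holderBound_local zero_le_one hh hs ht hts)
    intro u v hu huv hv
    refine (h1 u v hu huv hv).trans ?_
    refine mul_le_mul_of_nonneg_right ?_ (Real.rpow_nonneg (by linarith) _)
    have := mul_le_mul_of_nonneg_left hE1 hL
    rw [← hE]
    linarith
  have key := abs_integral_add_le hβ hβγ hγ1 hθ (by positivity) (by positivity) hG hst hts hh1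
    (hval b hb hbB) (hval σ hσ hσB s ⟨le_rfl, hst⟩) hφ (hg.mono hs ht) hI
  rw [hinc]
  refine key.trans ?_
  refine mul_le_mul_of_nonneg_right ?_ (Real.rpow_nonneg (by linarith) _)
  -- The whole bound is linear in E, so the smallness condition on h does not involve the weight.
  have := mul_le_mul_of_nonneg_right hsmall (zero_le_one.trans hE1)
  linarith

/-- The Picard map contracts the weighted distance by a factor `2` at a small scale. -/
theorem IsPicardStep.weightedBound_sub {σ' : ℝ → ℝ → ℝ} (hL : 0 ≤ L) (hb : JointLipschitz b L)
    (hσ : JointLipschitz σ L) (hd : ∀ t x, 0 ≤ t → HasDerivAt (σ t) (σ' t x) x)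
    (hbd : ∀ t x, 0 ≤ t → |σ' t x| ≤ L) (hσ' : JointLipschitz σ' L)
    (hβ : 0 < β) (hβγ : β < γ) (hγ1 : γ ≤ 1) (hθ : 1 < β + γ)
    (hG : 0 ≤ G) (hg : HolderBound g G γ 0 T) {R D h : ℝ} (hh : 0 < h) (hh1 : h ≤ 1)
    (hR : 0 ≤ R) (hD : 0 ≤ D)
    (hsmall : (2 * L + (2 * L + youngConst (β + γ) * (L + L * (1 + 2 * R) * 2)) * G) * h ^ (γ - β)
      ≤ 1 / 2)
    {x₁ x₂ y₁ y₂ : ℝ → ℝ} (hx0 : x₁ 0 = x₂ 0)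
    (hx₁ : HolderBound x₁ R β 0 T) (hx₂ : HolderBound x₂ R β 0 T)
    (hx : WeightedBound (fun t => x₁ t - x₂ t) D β h T)
    (h₁ : IsPicardStep b σ g x₀ T x₁ y₁) (h₂ : IsPicardStep b σ g x₀ T x₂ y₂) :
    WeightedBound (fun t => y₁ t - y₂ t) (D / 2) β h T := by
  intro s t hs hst ht hts
  obtain ⟨I₁, hI₁, hinc₁⟩ := h₁.exists_increment hL hb hσ hβ (by linarith) (by linarith) hθ
    hR hG hg hx₁ hs hst ht
  obtain ⟨I₂, hI₂, hinc₂⟩ := h₂.exists_increment hL hb hσ hβ (by linarith) (by linarith) hθ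
    hR hG hg hx₂ hs hst ht
  have hint₁ := intervalIntegrable_drift hL hb hβ (by linarith) hx₁
    (s := s) (t := t) ⟨hs, hst.trans ht⟩ ⟨hs.trans hst, ht⟩
  have hint₂ := intervalIntegrable_drift hL hb hβ (by linarith) hx₂
    (s := s) (t := t) ⟨hs, hst.trans ht⟩ ⟨hs.trans hst, ht⟩
  set E := Real.exp (t / h) with hE
  have hE0 : 0 ≤ E := Real.exp_nonneg _
  have hsup : ∀ τ ∈ Icc s t, |x₁ τ - x₂ τ| ≤ 2 * D * E := by
    intro τ hτ
    have := hx.abs_sub_zero_le hβ.le hD hh (t := τ) ⟨hs.trans hτ.1, hτ.2.trans ht⟩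
    simp only [hx0, sub_self, sub_zero] at this
    refine this.trans ?_
    have e1 : h ^ β ≤ 1 := Real.rpow_le_one hh.le hh1 hβ.le
    have e2 : Real.exp (τ / h) ≤ E := by
      rw [hE]; have := hτ.2; gcongr
    calc 2 * D * h ^ β * Real.exp (τ / h) ≤ 2 * D * 1 * E := by gcongr
      _ = _ := by ring
  have hval : ∀ k : ℝ → ℝ → ℝ, JointLipschitz k L →
      ∀ τ ∈ Icc s t, |k τ (x₁ τ) - k τ (x₂ τ)| ≤ 2 * L * D * E := by
    intro k hk τ hτ
    have h1 := hk τ τ (x₁ τ) (x₂ τ) (hs.trans hτ.1) (hs.trans hτ.1)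
    have h3 := mul_le_mul_of_nonneg_left (hsup τ hτ) hL
    rw [sub_self, abs_zero, zero_add] at h1
    linarith
  -- The L comes from the increment of x₁ − x₂; the other summand pairs the curves' own increments
  -- (1 + 2R) with the supremum bound 2DE.
  have hφ : HolderBound (fun τ => σ τ (x₁ τ) - σ τ (x₂ τ))
      ((L + L * (1 + 2 * R) * 2) * D * E) β s t := by
    intro u v hu huv hv
    have hvu : 0 ≤ v - u := by linarith
    refine (abs_four_point_le hL hd hbd hσ' (by linarith : 0 ≤ u) (by linarith : 0 ≤ v)
      (x₁ u) (x₁ v) (x₂ u) (x₂ v)).trans ?_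
    have e1 := hx.holderBound_local hD hh hs ht hts u v hu huv hv
    have e2 := hx₁ u v (hs.trans hu) huv (hv.trans ht)
    have e3 := hx₂ u v (hs.trans hu) huv (hv.trans ht)
    have e4 := hsup u ⟨hu, huv.trans hv⟩
    have e5 := le_rpow_of_le_one hvu (by linarith) hβ (by linarith)
    have e6 : |v - u| + (|x₁ v - x₁ u| + |x₂ v - x₂ u|) ≤ (1 + 2 * R) * (v - u) ^ β := by
      rw [abs_of_nonneg hvu]; linarith
    calc L * |x₁ v - x₂ v - (x₁ u - x₂ u)|
          + L * (|v - u| + (|x₁ v - x₁ u| + |x₂ v - x₂ u|)) * |x₁ u - x₂ u|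
        ≤ L * (D * E * (v - u) ^ β) + L * ((1 + 2 * R) * (v - u) ^ β) * (2 * D * E) := by
          gcongr
      _ = _ := by ring
  have key := abs_integral_add_le hβ hβγ hγ1 hθ (by positivity) (by positivity) hG hst hts hh1
    (hval b hb) (hval σ hσ s ⟨le_rfl, hst⟩) hφ (hg.mono hs ht) (hI₁.sub hI₂)
  rw [intervalIntegral.integral_sub hint₁ hint₂] at key
  have hsplit : y₁ t - y₂ t - (y₁ s - y₂ s) = (∫ τ in s..t, b τ (x₁ τ))
      - (∫ τ in s..t, b τ (x₂ τ)) + (I₁ - I₂) := by linarith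
  dsimp only
  rw [hsplit]
  refine key.trans ?_
  refine mul_le_mul_of_nonneg_right ?_ (Real.rpow_nonneg (by linarith) _)
  have := mul_le_mul_of_nonneg_right hsmall (mul_nonneg hD hE0)
  linarith

end Picard

/-! ### Uniqueness and existence of the fixed point -/

lemma HolderOn.exists_holderBound {f : ℝ → ℝ} {β : ℝ≥0} {a b : ℝ} (hf : HolderOn β f (Icc a b)) :
    ∃ A, 0 ≤ A ∧ HolderBound f A β a b := by
  obtain ⟨C, hC⟩ := hf
  refine ⟨C, C.2, fun u v hu huv hv => ?_⟩
  have := hC.dist_le (x := v) (y := u) ⟨hu.trans huv, hv⟩ ⟨hu, huv.trans hv⟩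
  rwa [Real.dist_eq, Real.dist_eq, abs_of_nonneg (by linarith : 0 ≤ v - u)] at this

lemma HolderBound.holderOn {f : ℝ → ℝ} {A a b : ℝ} {β : ℝ≥0} (hA : 0 ≤ A)
    (hf : HolderBound f A β a b) : HolderOn β f (Icc a b) := by
  refine ⟨A.toNNReal, fun x hx y hy => ?_⟩
  have key : |f x - f y| ≤ A * |x - y| ^ (β : ℝ) := by
    rcases le_total y x with h | h
    · rw [abs_of_nonneg (by linarith : 0 ≤ x - y)]
      exact hf y x hy.1 h hx.2
    · rw [abs_sub_comm, abs_sub_comm x, abs_of_nonneg (by linarith : 0 ≤ y - x)]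
      exact hf x y hx.1 h hy.2
  rw [edist_dist, edist_dist, Real.dist_eq, Real.dist_eq,
    ENNReal.ofReal_rpow_of_nonneg (abs_nonneg _) β.coe_nonneg]
  change _ ≤ ENNReal.ofReal A * _
  rw [← ENNReal.ofReal_mul hA]
  exact ENNReal.ofReal_le_ofReal key

lemma exists_pos_le_mul_rpow_le (C : ℝ) {c ε H : ℝ} (hc : 0 < c) (hε : 0 < ε) (hH : 0 < H) :
    ∃ h, 0 < h ∧ h ≤ H ∧ C * h ^ c ≤ ε := by
  have h1 : ContinuousAt (fun h : ℝ => C * h ^ c) 0 :=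
    continuousAt_const.mul (Real.continuousAt_rpow_const _ _ (Or.inr hc.le))
  have h2 : Tendsto (fun h : ℝ => C * h ^ c) (𝓝[>] 0) (𝓝 0) := by
    have := h1.tendsto.mono_left (nhdsWithin_le_nhds (s := Ioi 0))
    simpa [Real.zero_rpow hc.ne'] using this
  obtain ⟨h, ha, hb⟩ := ((h2.eventually_le_const hε).and (Ioc_mem_nhdsGT hH)).exists
  exact ⟨h, hb.1, hb.2, ha⟩

lemma WeightedBound.of_tendsto {x : ℕ → ℝ → ℝ} {y : ℝ → ℝ} {M β h T : ℝ}
    (hx : ∀ n, WeightedBound (x n) M β h T)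
    (hlim : ∀ t ∈ Icc 0 T, Tendsto (fun n => x n t) atTop (𝓝 (y t))) :
    WeightedBound y M β h T := fun s t hs hst ht hts =>
  le_of_tendsto' ((hlim t ⟨hs.trans hst, ht⟩).sub (hlim s ⟨hs, hst.trans ht⟩)).abs
    (fun n => hx n s t hs hst ht hts)

section Equation

variable {b σ σ' : ℝ → ℝ → ℝ} {g : ℝ → ℝ} {x₀ T L G β γ : ℝ}

theorem IsPicardStep.eqOn (hL : 0 ≤ L) (hb : JointLipschitz b L)
    (hσ : JointLipschitz σ L) (hd : ∀ t x, 0 ≤ t → HasDerivAt (σ t) (σ' t x) x)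
    (hbd : ∀ t x, 0 ≤ t → |σ' t x| ≤ L) (hσ' : JointLipschitz σ' L)
    (hβ : 0 < β) (hβγ : β < γ) (hγ1 : γ ≤ 1) (hθ : 1 < β + γ)
    (hG : 0 ≤ G) (hg : HolderBound g G γ 0 T) (hT : 0 ≤ T) {R : ℝ} (hR : 0 ≤ R) {x y : ℝ → ℝ}
    (hxR : HolderBound x R β 0 T) (hyR : HolderBound y R β 0 T)
    (hx : IsPicardStep b σ g x₀ T x x) (hy : IsPicardStep b σ g x₀ T y y) :
    EqOn x y (Icc 0 T) := by
  obtain ⟨h, hh, hh1, hsmall⟩ := exists_pos_le_mul_rpow_le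
    (2 * L + (2 * L + youngConst (β + γ) * (L + L * (1 + 2 * R) * 2)) * G)
    (sub_pos.2 hβγ) one_half_pos one_pos
  have h0 : x 0 = y 0 := (hx.apply_zero hT).trans (hy.apply_zero hT).symm
  -- Both curves are fixed, so the contraction applies repeatedly to the same difference, starting
  -- from the trivial bound 2R.
  have hD : ∀ n : ℕ, WeightedBound (fun t => x t - y t) (2 * R / 2 ^ n) β h T := by
    intro n
    induction n with
    | zero =>
      refine HolderBound.weightedBound (by positivity) hh fun u v hu huv hv => ?_
      have e1 := hxR u v hu huv hv
      have e2 := hyR u v hu huv hv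
      rw [abs_le] at e1 e2 ⊢
      rw [pow_zero, div_one]
      constructor <;> linarith
    | succ n ih =>
      have := IsPicardStep.weightedBound_sub hL hb hσ hd hbd hσ' hβ hβγ hγ1 hθ hG hg hh hh1 hR
        (by positivity) hsmall h0 hxR hyR ih hx hy
      rwa [div_div, ← pow_succ] at this
  intro t ht
  have hbound : ∀ n : ℕ, |x t - y t| ≤ 2 * (2 * R / 2 ^ n) * h ^ β * Real.exp (t / h) := by
    intro n
    have := (hD n).abs_sub_zero_le hβ.le (by positivity) hh ht
    simpa only [h0, sub_self, sub_zero] using this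
  have hlim : Tendsto (fun n : ℕ => 2 * (2 * R / 2 ^ n) * h ^ β * Real.exp (t / h)) atTop
      (𝓝 (2 * 0 * h ^ β * Real.exp (t / h))) :=
    (((Tendsto.div_atTop tendsto_const_nhds
      (tendsto_pow_atTop_atTop_of_one_lt one_lt_two)).const_mul 2).mul_const _).mul_const _
  have := ge_of_tendsto' hlim hbound
  rw [mul_zero, zero_mul, zero_mul] at this
  exact sub_eq_zero.1 (abs_nonpos_iff.1 this)

theorem exists_isPicardStep_self (hL : 0 ≤ L) (hb : JointLipschitz b L)
    (hσ : JointLipschitz σ L) (hd : ∀ t x, 0 ≤ t → HasDerivAt (σ t) (σ' t x) x)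
    (hbd : ∀ t x, 0 ≤ t → |σ' t x| ≤ L) (hσ' : JointLipschitz σ' L)
    (hβ : 0 < β) (hβγ : β < γ) (hγ1 : γ ≤ 1) (hθ : 1 < β + γ)
    (hG : 0 ≤ G) (hg : HolderBound g G γ 0 T) (hT : 0 ≤ T) {B : ℝ} (hB : 0 ≤ B)
    (hbB : ∀ t ∈ Icc 0 T, |b t x₀| ≤ B) (hσB : ∀ t ∈ Icc 0 T, |σ t x₀| ≤ B) :
    ∃ x R, 0 ≤ R ∧ HolderBound x R β 0 T ∧ IsPicardStep b σ g x₀ T x x := by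
  obtain ⟨h₁, hh₁, hh₁1, hsmall₁⟩ := exists_pos_le_mul_rpow_le
    (B + 2 * L + (B + 2 * L + youngConst (β + γ) * (2 * L)) * G)
    (sub_pos.2 hβγ) one_pos one_pos
  -- All iterates stay in the unit ball at scale h₁ and share this Hölder constant; only then can
  -- the contraction scale h be chosen.
  set R := 4 * 1 * Real.exp (T / h₁) with hRdef
  have hR : 0 ≤ R := by positivity
  obtain ⟨h, hh, hh1, hsmall⟩ := exists_pos_le_mul_rpow_le
    (2 * L + (2 * L + youngConst (β + γ) * (L + L * (1 + 2 * R) * 2)) * G)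
    (sub_pos.2 hβγ) one_half_pos one_pos
  have hstep : ∀ x : {x : ℝ → ℝ // x 0 = x₀ ∧ WeightedBound x 1 β h₁ T},
      ∃ y : {x : ℝ → ℝ // x 0 = x₀ ∧ WeightedBound x 1 β h₁ T}, IsPicardStep b σ g x₀ T x y := by
    rintro ⟨x, hx0, hx⟩
    obtain ⟨y, hy⟩ := exists_isPicardStep (b := b) (x₀ := x₀) hL hσ hβ (by linarith)
      (by linarith) hθ hR hG hT hg (hx.holderBound hβ.le zero_le_one hh₁)
    exact ⟨⟨y, hy.apply_zero hT, hy.weightedBound hL hb hσ hβ hβγ hγ1 hθ hG hg hh₁ hh₁1 hB hbB hσB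
      hsmall₁ hx0 hx⟩, hy⟩
  choose Φ hΦ using hstep
  let z : ℕ → {x : ℝ → ℝ // x 0 = x₀ ∧ WeightedBound x 1 β h₁ T} := fun n =>
    Φ^[n] ⟨fun _ => x₀, rfl, fun s t hs hst ht _ => by
      rw [sub_self, abs_zero]
      have : 0 ≤ t - s := by linarith
      positivity⟩
  have hz : ∀ n, IsPicardStep b σ g x₀ T (z n) (z (n + 1)) := fun n => by
    simp only [z, Function.iterate_succ_apply']
    exact hΦ _
  have hzR : ∀ n, HolderBound (z n) R β 0 T := fun n =>
    (z n).2.2.holderBound hβ.le zero_le_one hh₁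
  have hdiff : ∀ n, WeightedBound (fun t => (z n).1 t - (z (n + 1)).1 t) (2 * R / 2 ^ n) β h T := by
    intro n
    induction n with
    | zero =>
      refine HolderBound.weightedBound (by positivity) hh fun u v hu huv hv => ?_
      have e1 := hzR 0 u v hu huv hv
      have e2 := hzR 1 u v hu huv hv
      rw [abs_le] at e1 e2 ⊢
      rw [pow_zero, div_one]
      constructor <;> linarith
    | succ n ih =>
      have := IsPicardStep.weightedBound_sub hL hb hσ hd hbd hσ' hβ hβγ hγ1 hθ hG hg hh hh1 hR
        (by positivity) hsmall ((z n).2.1.trans (z (n + 1)).2.1.symm) (hzR n) (hzR (n + 1)) ih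
        (hz n) (hz (n + 1))
      rwa [div_div, ← pow_succ] at this
  have hlim : ∀ t, ∃ l, t ∈ Icc 0 T → Tendsto (fun n => (z n).1 t) atTop (𝓝 l) := by
    intro t
    by_cases ht : t ∈ Icc 0 T
    · have hcs : CauchySeq (fun n => (z n).1 t) := by
        refine cauchySeq_of_le_geometric_two
          (C := 2 * (2 * (2 * R) * h ^ β * Real.exp (t / h))) fun n => ?_
        have := (hdiff n).abs_sub_zero_le hβ.le (by positivity) hh ht
        rw [(z n).2.1, (z (n + 1)).2.1, sub_self, sub_zero] at this
        rw [Real.dist_eq]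
        refine this.trans_eq ?_
        ring
      obtain ⟨l, hl⟩ := cauchySeq_tendsto_of_complete hcs
      exact ⟨l, fun _ => hl⟩
    · exact ⟨0, fun h => absurd h ht⟩
  choose x hx using hlim
  have hxW : WeightedBound x 1 β h₁ T := .of_tendsto (fun n => (z n).2.2) hx
  have hxR : HolderBound x R β 0 T := hxW.holderBound hβ.le zero_le_one hh₁
  have hx0 : x 0 = x₀ := tendsto_nhds_unique (hx 0 ⟨le_rfl, hT⟩)
    (by simp only [(z _).2.1]; exact tendsto_const_nhds)
  -- Summing the geometric tail doubles the gap 2R / 2^n between consecutive iterates.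
  have hclose : ∀ n, WeightedBound (fun t => (z n).1 t - x t) (4 * R / 2 ^ n) β h T := by
    intro n s t hs hst ht hts
    have hu : ∀ k, dist ((z k).1 t - (z k).1 s) ((z (k + 1)).1 t - (z (k + 1)).1 s)
        ≤ 4 * R * Real.exp (t / h) * (t - s) ^ β / 2 / 2 ^ k := by
      intro k
      have := hdiff k s t hs hst ht hts
      rw [Real.dist_eq]
      refine le_of_eq_of_le (congrArg abs ?_) (this.trans_eq ?_) <;> ring
    have := dist_le_of_le_geometric_two_of_tendsto hu
      ((hx t ⟨hs.trans hst, ht⟩).sub (hx s ⟨hs, hst.trans ht⟩)) n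
    rw [Real.dist_eq] at this
    refine le_of_eq_of_le (congrArg abs ?_) (this.trans_eq ?_) <;> ring
  -- Contraction makes the iterates converge to the Picard image y of x as well, so y = x on [0, T].
  obtain ⟨y, hy⟩ := exists_isPicardStep (b := b) (x₀ := x₀) hL hσ hβ (by linarith)
    (by linarith) hθ hR hG hT hg hxR
  have hyx : ∀ t ∈ Icc 0 T, y t = x t := by
    intro t ht
    have hbound : ∀ n, dist ((z (n + 1)).1 t) (y t)
        ≤ 2 * (4 * R / 2 ^ n / 2) * h ^ β * Real.exp (t / h) := by
      intro n
      have := (IsPicardStep.weightedBound_sub hL hb hσ hd hbd hσ' hβ hβγ hγ1 hθ hG hg hh hh1 hR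
        (by positivity) hsmall ((z n).2.1.trans hx0.symm) (hzR n) hxR (hclose n)
        (hz n) hy).abs_sub_zero_le hβ.le (by positivity) hh ht
      rwa [(z (n + 1)).2.1, hy.apply_zero hT, sub_self, sub_zero, ← Real.dist_eq] at this
    have hlim : Tendsto (fun n : ℕ => 2 * (4 * R / 2 ^ n / 2) * h ^ β * Real.exp (t / h)) atTop
        (𝓝 (2 * (0 / 2) * h ^ β * Real.exp (t / h))) :=
      ((((Tendsto.div_atTop tendsto_const_nhds (tendsto_pow_atTop_atTop_of_one_lt
        one_lt_two)).div_const 2).const_mul 2).mul_const _).mul_const _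
    rw [zero_div, mul_zero, zero_mul, zero_mul] at hlim
    exact tendsto_nhds_unique (tendsto_iff_dist_tendsto_zero.2
      (squeeze_zero (fun _ => dist_nonneg) hbound hlim)) ((tendsto_add_atTop_iff_nat 1).2 (hx t ht))
  refine ⟨x, R, hR, hxR, fun t ht => ?_⟩
  rw [← hyx t ht]
  exact hy t ht

end Equation

/-! ### From the hypotheses to the quantitative bounds -/

/-- The vertical line through (t, x) stays in the closed half-plane, so differentiability within it
gives a two-sided x-derivative even at t = 0. -/
lemma hasDerivAt_partialX {σ : ℝ → ℝ → ℝ}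
    (hσ : ContDiffOn ℝ 1 (fun p : ℝ × ℝ => σ p.1 p.2) (Ici 0 ×ˢ univ)) {t : ℝ} (ht : 0 ≤ t)
    (x : ℝ) : HasDerivAt (σ t) (partialX σ t x) x := by
  have h1 := hσ.differentiableOn one_ne_zero (t, x) ⟨ht, mem_univ _⟩
  have h2 : DifferentiableWithinAt ℝ (fun y : ℝ => (t, y)) univ x := by fun_prop
  have h3 := h1.comp x h2 (fun y _ => ⟨ht, mem_univ _⟩)
  exact (differentiableWithinAt_univ.1 h3).hasDerivAt

lemma JointLipschitz.abs_partialX_le {σ : ℝ → ℝ → ℝ} {L : ℝ} (hL : 0 ≤ L)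
    (hσ : JointLipschitz σ L) {t : ℝ} (ht : 0 ≤ t) (x : ℝ) : |partialX σ t x| ≤ L := by
  refine norm_deriv_le_of_lip' (f := σ t) hL (Eventually.of_forall fun y => ?_)
  simpa using hσ t t y x ht ht

lemma JointLipschitz.abs_apply_le {k : ℝ → ℝ → ℝ} {L : ℝ} (hL : 0 ≤ L)
    (hk : JointLipschitz k L) (x₀ T : ℝ) : ∀ t ∈ Icc 0 T, |k t x₀| ≤ |k 0 x₀| + L * T := by
  intro t ht
  have h1 := hk 0 t x₀ x₀ le_rfl ht.1
  rw [sub_self, abs_zero, add_zero, sub_zero, abs_of_nonneg ht.1] at h1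
  have h2 := mul_le_mul_of_nonneg_left ht.2 hL
  have := abs_sub_abs_le_abs_sub (k t x₀) (k 0 x₀)
  linarith

lemma IsSolution.isPicardStep {b σ : ℝ → ℝ → ℝ} {g x : ℝ → ℝ} {x₀ T : ℝ}
    (h : IsSolution b σ g x₀ T x) : IsPicardStep b σ g x₀ T x x :=
  fun t ht => (h.2 t ht).2

theorem theorem3 (b σ : ℝ → ℝ → ℝ) (g : ℝ → ℝ) (γ : ℝ≥0) (x₀ : ℝ)
    (hγ : (1 / 2 : ℝ) < γ) (hγ1 : (γ : ℝ) ≤ 1)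
    (hg : ∀ R : ℝ, 0 < R → HolderOn γ g (Icc 0 R))
    (hb : GloballyLipschitz b)
    (hσ : ContDiffOn ℝ 1 (fun p : ℝ × ℝ => σ p.1 p.2) (Ici 0 ×ˢ univ))
    (hσL : GloballyLipschitz σ)
    (hσt : GloballyLipschitz (partialT σ))
    (hσx : GloballyLipschitz (partialX σ)) :
    ∀ (T : ℝ) (β : ℝ≥0), 0 < T → (1 : ℝ) - γ < β → (β : ℝ) < γ →
      ∃ x : ℝ → ℝ, (HolderOn β x (Icc 0 T) ∧ IsSolution b σ g x₀ T x) ∧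
        ∀ y : ℝ → ℝ, HolderOn β y (Icc 0 T) → IsSolution b σ g x₀ T y →
          EqOn y x (Icc 0 T) := by
  intro T β hT hβ1 hβγ
  obtain ⟨G, hG, hgG⟩ := (hg T hT).exists_holderBound
  obtain ⟨L₁, hL₁, h₁⟩ := hb.exists_jointLipschitz
  obtain ⟨L₂, hL₂, h₂⟩ := hσL.exists_jointLipschitz
  obtain ⟨L₃, hL₃, h₃⟩ := hσx.exists_jointLipschitz
  have hL : 0 ≤ L₁ + L₂ + L₃ := by positivity
  have hbL : JointLipschitz b (L₁ + L₂ + L₃) := h₁.mono (by linarith)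
  have hσL' : JointLipschitz σ (L₁ + L₂ + L₃) := h₂.mono (by linarith)
  have hσxL : JointLipschitz (partialX σ) (L₁ + L₂ + L₃) := h₃.mono (by linarith)
  have hβ : (0 : ℝ) < β := by linarith
  have hθ : (1 : ℝ) < β + γ := by linarith
  have hd : ∀ t x, 0 ≤ t → HasDerivAt (σ t) (partialX σ t x) x :=
    fun t x ht => hasDerivAt_partialX hσ ht x
  have hbd : ∀ t x, 0 ≤ t → |partialX σ t x| ≤ L₁ + L₂ + L₃ :=
    fun t x ht => hσL'.abs_partialX_le hL ht x
  obtain ⟨x, R, hR, hxR, hx⟩ := exists_isPicardStep_self (x₀ := x₀)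
    (B := |b 0 x₀| + |σ 0 x₀| + (L₁ + L₂ + L₃) * T) hL hbL hσL' hd
    hbd hσxL hβ hβγ hγ1 hθ hG hgG hT.le (by positivity)
    (fun t ht => (hbL.abs_apply_le hL x₀ T t ht).trans (by linarith [abs_nonneg (σ 0 x₀)]))
    (fun t ht => (hσL'.abs_apply_le hL x₀ T t ht).trans (by linarith [abs_nonneg (b 0 x₀)]))
  refine ⟨x, ⟨hxR.holderOn hR, hx.apply_zero hT.le, fun t ht =>
    ⟨intervalIntegrable_drift hL hbL hβ (by linarith) hxR ⟨le_rfl, hT.le⟩ ht, hx t ht⟩⟩, ?_⟩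
  intro y hyH hy
  obtain ⟨R', hR', hyR⟩ := hyH.exists_holderBound
  have hmono : ∀ {f : ℝ → ℝ} {A A' : ℝ}, A ≤ A' → HolderBound f A β 0 T →
      HolderBound f A' β 0 T := fun hA hf u v hu huv hv =>
    (hf u v hu huv hv).trans
      (mul_le_mul_of_nonneg_right hA (Real.rpow_nonneg (sub_nonneg.2 huv) _))
  -- The sum R + R' serves as a common Hölder constant for the two solutions.
  exact IsPicardStep.eqOn hL hbL hσL' hd hbd hσxL hβ hβγ hγ1 hθ hG hgG hT.le
    (add_nonneg hR hR') (hmono (by linarith) hyR) (hmono (by linarith) hxR) hy.isPicardStep hx
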